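/- For $x\in\mathbb{R}$ let $\|x\|=\min_{n\in\mathbb{Z}}|x-n|$ denote the distance from $x$ to the nearest integer. For $\Theta=(\theta_1,\theta_2)\in\mathbb{R}^2$ put $$\mathrm{BAD}^{\Theta}\left(\tfrac23,\tfrac13\right)=\left\{(\eta_1,\eta_2)\in\mathbb{R}^2:\ \inf_{q\in\mathbb{Z},\,q\ge 1}\max\left(q^{2/3}\|q\theta_1-\eta_1\|,\ q^{1/3}\|q\theta_2-\eta_2\|\right)>0\right\}.$$ Theorem. For every $\Theta\in\mathbb{R}^2$ the set $\mathrm{BAD}^{\Theta}(2/3,1/3)$ is non-empty; moreover, it has full Hausdorff dimension in $\mathbb{R}^2$, that is, its Hausdorff dimension is $2$. -/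

import Mathlib

/-- The distance `‖x‖` from the real number `x` to the nearest integer. -/
noncomputable def distNearestInt (x : ℝ) : ℝ := |x - (round x : ℝ)|

theorem distNearestInt_nonneg (x : ℝ) : 0 ≤ distNearestInt x := abs_nonneg _

/-- `distNearestInt x` is the least of the distances from `x` to the integers. -/
theorem isLeast_distNearestInt (x : ℝ) :
    IsLeast (Set.range fun n : ℤ => |x - (n : ℝ)|) (distNearestInt x) :=
  ⟨⟨round x, rfl⟩, by rintro _ ⟨n, rfl⟩; exact round_le x n⟩

/-- The inhomogeneous weighted set `BAD^Θ(α, β)`: all `η = (η₁, η₂)` in the plane with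
`inf_{q ≥ 1} max (q^α ‖q θ₁ - η₁‖, q^β ‖q θ₂ - η₂‖) > 0`. The coordinates `1, 2` are indexed
by `0, 1`. -/
noncomputable def inhomBad (α β : ℝ) (Θ : EuclideanSpace ℝ (Fin 2)) :
    Set (EuclideanSpace ℝ (Fin 2)) :=
  {η | 0 < ⨅ q : ℕ+, max ((q : ℝ) ^ α * distNearestInt ((q : ℝ) * Θ 0 - η 0))
                         ((q : ℝ) ^ β * distNearestInt ((q : ℝ) * Θ 1 - η 1))}

/-!
The inhomogeneous condition on `η` is first replaced by a condition on countably many families of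
parallel lines. Measure `m ∈ ℤ²` by the weighted norm `max (|m₁| ^ (1 / 2), |m₂|)`, fix a large
integer `b`, and let `v n` be a vector in the shell `b ^ (n - 1) < ‖m‖ ≤ b ^ n` that minimizes the
distance from `v n · Θ` to the integers. By the pigeonhole principle every box `‖m‖ ≤ b ^ t`
contains a nonzero `m` for which `m · Θ` is within `b ^ (-3 t)` of an integer, so some `v n` with
`n ≤ t` does as well (`exists_shell_vectors`). Suppose that `v n · η` is at least `ε` away from
the integers for all `n`. For `q` of size `ε b ^ (3 t)` the number `v n · (q Θ - η)` is then at
least `ε / 2` away from the integers, while it is at most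
`b ^ (2 t) ‖q θ₁ - η₁‖ + b ^ t ‖q θ₂ - η₂‖` away from them; this is the lower bound required
(`mem_inhomBad_of_shell_vectors`).

Such points `η` are found in a Cantor set built from rectangles with the same weights: a cell of
level `n` has sides `b ^ (-2 n)` and `b ^ (-n)` and is divided into `b ^ 2 * b` children. On a
cell of level `n + 1` the form `v n · η` approaches at most one integer, along one strip, and this
strip meets at most `7 b ^ 2` of the children, whatever the direction of `v n`
(`exists_children_avoiding`). It matters that the cells have the weights of the problem: many of
the `v n` may have about the same Euclidean length, but each level of the grid sees only one of
them.

Keeping `N = b ^ 2 * (b - 7)` children of every cell, one obtains a Cantor set with a probability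
measure that gives mass `N ^ (-n)` to each cell of level `n`. A set of diameter `b ^ (-2 n)` meets
at most `16 b ^ (2 n)` cells of level `2 n`, so its mass is at most `16 (b / N) ^ (2 n)`, and the
mass distribution principle gives dimension at least `s` as soon as `b ^ (1 + s) ≤ N`
(`le_dimH_of_codedPoint_mem`). For any `s < 2` this holds when `b` is large.
-/

/-! ### Small values of a linear form in weighted boxes -/

/-- Dirichlet's theorem for one linear form in two integer variables, in a box `H × K`. -/
theorem exists_int_linear_form_small (x y : ℝ) {H K : ℕ} (hH : 0 < H) (hK : 0 < K) :
    ∃ m : ℤ × ℤ, m ≠ 0 ∧ |m.1| ≤ H ∧ |m.2| ≤ K ∧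
      ∃ p : ℤ, |m.1 * x + m.2 * y - p| ≤ ((H : ℝ) * K)⁻¹ := by
  have hHK : (0 : ℝ) < (H : ℝ) * K := by positivity
  let f : ℕ × ℕ → ℕ := fun a => ⌊Int.fract (a.1 * x + a.2 * y) * ((H : ℝ) * K)⌋₊
  obtain ⟨a, ha, c, hc, hne, hf⟩ := Finset.exists_ne_map_eq_of_card_lt_of_maps_to
    (s := Finset.range (H + 1) ×ˢ Finset.range (K + 1)) (t := Finset.range (H * K)) (f := f)
    (by simp only [Finset.card_product, Finset.card_range]; nlinarith)
    (by
      intro a _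
      simp only [Finset.coe_range, Set.mem_Iio, f]
      rw [Nat.floor_lt (by have := Int.fract_nonneg (a.1 * x + a.2 * y); positivity)]
      push_cast
      have := Int.fract_lt_one (a.1 * x + a.2 * y)
      nlinarith)
  simp only [Finset.mem_product, Finset.mem_range] at ha hc
  refine ⟨((a.1 : ℤ) - c.1, (a.2 : ℤ) - c.2), ?_, ?_, ?_,
    ⌊a.1 * x + a.2 * y⌋ - ⌊c.1 * x + c.2 * y⌋, ?_⟩
  · intro h
    simp only [Prod.mk_eq_zero] at h
    exact hne (Prod.ext (by omega) (by omega))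
  · rw [abs_le]; constructor <;> simp only <;> omega
  · rw [abs_le]; constructor <;> simp only <;> omega
  · have hu := Int.fract_nonneg (a.1 * x + a.2 * y)
    have hv := Int.fract_nonneg (c.1 * x + c.2 * y)
    have h1 := Nat.floor_le (mul_nonneg hu hHK.le)
    have h2 := Nat.lt_floor_add_one (Int.fract (a.1 * x + a.2 * y) * ((H : ℝ) * K))
    have h3 := Nat.floor_le (mul_nonneg hv hHK.le)
    have h4 := Nat.lt_floor_add_one (Int.fract (c.1 * x + c.2 * y) * ((H : ℝ) * K))
    simp only [f] at hf
    rw [hf] at h1 h2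
    have key : |Int.fract (a.1 * x + a.2 * y) - Int.fract (c.1 * x + c.2 * y)| * ((H : ℝ) * K)
        ≤ 1 := by
      rw [show ∀ u : ℝ, |u| * ((H : ℝ) * K) = |u * (H * K)| from
        fun u => by rw [abs_mul, abs_of_pos hHK], abs_le]
      constructor <;> nlinarith
    rw [← one_div, le_div_iff₀ hHK]
    refine le_trans (le_of_eq ?_) key
    congr 2
    rw [Int.fract, Int.fract]
    push_cast
    ring

/-- One integer vector `v n` for each weighted shell
`{m : |m₁| ≤ b ^ (2 * n), |m₂| ≤ b ^ n, |m₁| > b ^ (2 * (n - 1)) or |m₂| > b ^ (n - 1)}`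
(for `n = 0`, where the exponents are negative, this says that `m` is a nonzero vector with entries
in `{-1, 0, 1}`), such that Dirichlet's bound at every scale `t` is attained by some `v n` with `n ≤ t`: take
for `v n` a vector of the shell at which the linear form is closest to an integer. -/
theorem exists_shell_vectors (x y : ℝ) {b : ℕ} (hb : 2 ≤ b) :
    ∃ v : ℕ → ℤ × ℤ,
      (∀ n, |(v n).1| ≤ (b : ℤ) ^ (2 * n) ∧ |(v n).2| ≤ (b : ℤ) ^ n ∧
        ((b : ℤ) ^ (2 * n) < b ^ 2 * |(v n).1| ∨ (b : ℤ) ^ n < b * |(v n).2|)) ∧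
      ∀ t, ∃ n ≤ t, ∃ p : ℤ, |(v n).1 * x + (v n).2 * y - p| ≤ ((b : ℝ) ^ (3 * t))⁻¹ := by
  have hbZ : (2 : ℤ) ≤ b := by exact_mod_cast hb
  let S : ℕ → Set (ℤ × ℤ) := fun n => {m | |m.1| ≤ (b : ℤ) ^ (2 * n) ∧ |m.2| ≤ (b : ℤ) ^ n ∧
        ((b : ℤ) ^ (2 * n) < b ^ 2 * |m.1| ∨ (b : ℤ) ^ n < b * |m.2|)}
  have hfin : ∀ n, (S n).Finite := by
    intro n
    refine (((Set.finite_Icc (-(b : ℤ) ^ (2 * n)) ((b : ℤ) ^ (2 * n))).prod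
      (Set.finite_Icc (-(b : ℤ) ^ n) ((b : ℤ) ^ n)))).subset ?_
    rintro m ⟨h1, h2, -⟩
    exact ⟨abs_le.1 h1, abs_le.1 h2⟩
  have hne : ∀ n, (S n).Nonempty := by
    intro n
    refine ⟨((b : ℤ) ^ (2 * n), 0), ?_, ?_, Or.inl ?_⟩
    · rw [abs_of_nonneg (by positivity)]
    · simp
    · have : (0 : ℤ) < (b : ℤ) ^ (2 * n) := by positivity
      rw [abs_of_nonneg (by positivity)]
      exact lt_mul_of_one_lt_left this (by nlinarith)
  choose v hv hmin using fun n => Set.exists_min_image (S n)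
    (fun m => distNearestInt (m.1 * x + m.2 * y)) (hfin n) (hne n)
  refine ⟨v, fun n => hv n, fun t => ?_⟩
  obtain ⟨m, hm0, hm1, hm2, p, hp⟩ := exists_int_linear_form_small x y
    (H := b ^ (2 * t)) (K := b ^ t) (by positivity) (by positivity)
  have hex : ∃ n, |m.1| ≤ (b : ℤ) ^ (2 * n) ∧ |m.2| ≤ (b : ℤ) ^ n :=
    ⟨t, by exact_mod_cast hm1, by exact_mod_cast hm2⟩
  classical
  have hn := Nat.find_spec hex
  have hmem : m ∈ S (Nat.find hex) := by
    refine ⟨hn.1, hn.2, ?_⟩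
    rcases hk : Nat.find hex with _ | k
    · have : m.1 ≠ 0 ∨ m.2 ≠ 0 := by
        by_contra! h
        exact hm0 (Prod.ext h.1 h.2)
      rcases this with h | h
      · left
        have := Int.one_le_abs h
        simp only [mul_zero, pow_zero]
        nlinarith
      · right
        have := Int.one_le_abs h
        simp only [pow_zero]
        nlinarith
    · have := Nat.find_min hex (m := k) (by omega)
      rw [not_and_or, not_le, not_le] at this
      have hb0 : (0 : ℤ) < b := by positivity
      rcases this with h | h
      · left
        rw [mul_add, mul_one, pow_add, mul_comm]
        exact mul_lt_mul_of_pos_left h (by positivity)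
      · right
        rw [pow_succ, mul_comm]
        exact mul_lt_mul_of_pos_left h hb0
  refine ⟨Nat.find hex, Nat.find_min' hex ⟨by exact_mod_cast hm1, by exact_mod_cast hm2⟩,
    round ((v (Nat.find hex)).1 * x + (v (Nat.find hex)).2 * y), ?_⟩
  refine (hmin _ m hmem).trans ((round_le _ p).trans (hp.trans (le_of_eq ?_)))
  push_cast
  rw [← pow_add]
  congr 2
  ring

/-! ### Transference -/

/-- A point `η` whose products with all the shell vectors stay away from the integers is
inhomogeneously badly approximable: for `q` of size about `b ^ (3 * t)`, pairing
`q • Θ - η` with the shell vector of scale `t` bounds the weighted distance from below. -/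
theorem mem_inhomBad_of_shell_vectors {Θ η : EuclideanSpace ℝ (Fin 2)} {b : ℕ} (hb : 2 ≤ b)
    {v : ℕ → ℤ × ℤ}
    (hv : ∀ n, |(v n).1| ≤ (b : ℤ) ^ (2 * n) ∧ |(v n).2| ≤ (b : ℤ) ^ n)
    (hΘ : ∀ t, ∃ n ≤ t, ∃ p : ℤ,
      |(v n).1 * Θ 0 + (v n).2 * Θ 1 - p| ≤ ((b : ℝ) ^ (3 * t))⁻¹)
    {ε : ℝ} (hε : 0 < ε) (hε1 : ε ≤ 1)
    (hη : ∀ n, ∀ p : ℤ, ε ≤ |(v n).1 * η 0 + (v n).2 * η 1 - p|) :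
    η ∈ inhomBad (2 / 3) (1 / 3) Θ := by
  have hb1 : (1 : ℝ) < b := by exact_mod_cast hb
  set K : ℝ := (b : ℝ) ^ 3 * (2 / ε) with hK
  have hK1 : 1 ≤ K := by
    have h1 : (1 : ℝ) ≤ (b : ℝ) ^ 3 := one_le_pow₀ hb1.le
    have h2 : 1 ≤ 2 / ε := by rw [le_div_iff₀ hε]; linarith
    nlinarith
  have hK0 : 0 < K := by linarith
  refine lt_of_lt_of_le (b := ε / (4 * K)) (by positivity) (le_ciInf fun q => ?_)
  have hq1 : (1 : ℝ) ≤ (q : ℝ) := by exact_mod_cast q.2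
  have hq0 : (0 : ℝ) < (q : ℝ) := by linarith
  have hex : ∃ t : ℕ, (q : ℝ) ≤ ε / 2 * (b : ℝ) ^ (3 * t) := by
    obtain ⟨t, ht⟩ := pow_unbounded_of_one_lt ((q : ℝ) * (2 / ε)) hb1
    refine ⟨t, ?_⟩
    have : (b : ℝ) ^ t ≤ (b : ℝ) ^ (3 * t) := pow_le_pow_right₀ hb1.le (by omega)
    calc (q : ℝ) = ε / 2 * (q * (2 / ε)) := by field_simp
      _ ≤ _ := by gcongr; linarith
  classical
  obtain ⟨t, ht, htmin⟩ : ∃ t : ℕ, (q : ℝ) ≤ ε / 2 * (b : ℝ) ^ (3 * t) ∧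
      (b : ℝ) ^ (3 * t) ≤ K * q := by
    refine ⟨Nat.find hex, Nat.find_spec hex, ?_⟩
    rcases hk : Nat.find hex with _ | k
    · simp only [mul_zero, pow_zero]
      nlinarith
    · have := Nat.find_min hex (m := k) (by omega)
      rw [not_le] at this
      rw [mul_add, mul_one, pow_add, hK]
      have h3 : (b : ℝ) ^ (3 * k) ≤ 2 / ε * q := by
        calc (b : ℝ) ^ (3 * k) = 2 / ε * (ε / 2 * (b : ℝ) ^ (3 * k)) := by field_simp
          _ ≤ _ := by gcongr
      calc (b : ℝ) ^ (3 * k) * (b : ℝ) ^ 3 ≤ 2 / ε * q * (b : ℝ) ^ 3 := by gcongr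
        _ = _ := by ring
  obtain ⟨n, hn, p, hp⟩ := hΘ t
  set d₀ := distNearestInt ((q : ℝ) * Θ 0 - η 0) with hd0
  set d₁ := distNearestInt ((q : ℝ) * Θ 1 - η 1) with hd1
  have hd0' : 0 ≤ d₀ := distNearestInt_nonneg _
  have hd1' : 0 ≤ d₁ := distNearestInt_nonneg _
  have hv1 : |((v n).1 : ℝ)| ≤ (b : ℝ) ^ (2 * t) := by
    have : |((v n).1 : ℝ)| ≤ (b : ℝ) ^ (2 * n) := by exact_mod_cast (hv n).1
    exact this.trans (pow_le_pow_right₀ hb1.le (by omega))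
  have hv2 : |((v n).2 : ℝ)| ≤ (b : ℝ) ^ t := by
    have : |((v n).2 : ℝ)| ≤ (b : ℝ) ^ n := by exact_mod_cast (hv n).2
    exact this.trans (pow_le_pow_right₀ hb1.le (by omega))
  -- The pairing with `v n` splits into the two coordinate errors and the value at `q • Θ`.
  have hmain : ε ≤ |((v n).1 : ℝ)| * d₀ + |((v n).2 : ℝ)| * d₁
      + q * |(v n).1 * Θ 0 + (v n).2 * Θ 1 - p| := by
    have h := hη n (q * p - (v n).1 * round ((q : ℝ) * Θ 0 - η 0)
      - (v n).2 * round ((q : ℝ) * Θ 1 - η 1))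
    have e : ((v n).1 * η 0 + (v n).2 * η 1
        - ((q * p - (v n).1 * round ((q : ℝ) * Θ 0 - η 0)
          - (v n).2 * round ((q : ℝ) * Θ 1 - η 1) : ℤ) : ℝ))
        = q * ((v n).1 * Θ 0 + (v n).2 * Θ 1 - p)
          + (-((v n).1 * ((q : ℝ) * Θ 0 - η 0 - round ((q : ℝ) * Θ 0 - η 0)))
          + -((v n).2 * ((q : ℝ) * Θ 1 - η 1 - round ((q : ℝ) * Θ 1 - η 1)))) := by
      push_cast
      ring
    rw [e] at h
    refine h.trans ((abs_add_le _ _).trans ?_)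
    have h2 := abs_add_le (-((v n).1 * ((q : ℝ) * Θ 0 - η 0 - round ((q : ℝ) * Θ 0 - η 0))))
      (-((v n).2 * ((q : ℝ) * Θ 1 - η 1 - round ((q : ℝ) * Θ 1 - η 1))))
    rw [abs_neg, abs_neg, abs_mul, abs_mul] at h2
    rw [abs_mul, abs_of_pos hq0]
    simp only [distNearestInt] at hd0 hd1
    rw [hd0, hd1]
    linarith
  have hlast : q * |(v n).1 * Θ 0 + (v n).2 * Θ 1 - p| ≤ ε / 2 := by
    calc q * |(v n).1 * Θ 0 + (v n).2 * Θ 1 - p|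
        ≤ (ε / 2 * (b : ℝ) ^ (3 * t)) * ((b : ℝ) ^ (3 * t))⁻¹ := by gcongr
      _ = ε / 2 := by field_simp
  have hrt : ∀ s : ℕ, s ≤ 2 → (b : ℝ) ^ (s * t) ≤ K * (q : ℝ) ^ ((s : ℝ) / 3) := by
    intro s hs
    have h1 : (b : ℝ) ^ (s * t) = ((b : ℝ) ^ (3 * t)) ^ ((s : ℝ) / 3) := by
      rw [← Real.rpow_natCast, ← Real.rpow_natCast, ← Real.rpow_mul (by positivity)]
      congr 1
      push_cast
      ring
    have hs' : (s : ℝ) / 3 ≤ 1 := by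
      have : (s : ℝ) ≤ 2 := by exact_mod_cast hs
      linarith
    rw [h1]
    calc ((b : ℝ) ^ (3 * t)) ^ ((s : ℝ) / 3) ≤ (K * q) ^ ((s : ℝ) / 3) := by gcongr
      _ = K ^ ((s : ℝ) / 3) * (q : ℝ) ^ ((s : ℝ) / 3) := Real.mul_rpow hK0.le hq0.le
      _ ≤ K * (q : ℝ) ^ ((s : ℝ) / 3) := by
          gcongr
          exact Real.rpow_le_self_of_one_le hK1 hs'
  have h2 := hrt 2 le_rfl
  have h1 := hrt 1 one_le_two
  simp only [Nat.cast_ofNat, Nat.cast_one, one_mul] at h1 h2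
  set M := max ((q : ℝ) ^ (2 / 3 : ℝ) * d₀) ((q : ℝ) ^ (1 / 3 : ℝ) * d₁)
  have hM0 : (q : ℝ) ^ (2 / 3 : ℝ) * d₀ ≤ M := le_max_left _ _
  have hM1 : (q : ℝ) ^ (1 / 3 : ℝ) * d₁ ≤ M := le_max_right _ _
  have e0 : |((v n).1 : ℝ)| * d₀ ≤ K * M := by
    calc |((v n).1 : ℝ)| * d₀ ≤ K * (q : ℝ) ^ (2 / 3 : ℝ) * d₀ := by
          gcongr; exact hv1.trans h2
      _ = K * ((q : ℝ) ^ (2 / 3 : ℝ) * d₀) := by ring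
      _ ≤ _ := by gcongr
  have e1 : |((v n).2 : ℝ)| * d₁ ≤ K * M := by
    calc |((v n).2 : ℝ)| * d₁ ≤ K * (q : ℝ) ^ (1 / 3 : ℝ) * d₁ := by
          gcongr; exact hv2.trans h1
      _ = K * ((q : ℝ) ^ (1 / 3 : ℝ) * d₁) := by ring
      _ ≤ _ := by gcongr
  rw [div_le_iff₀ (by positivity)]
  linarith

/-! ### Cantor sets on a weighted grid -/

/-- A cell of the weighted grid of level `n`: the rectangle with sides `b ^ (-2 n)` and `b ^ (-n)`
whose lower left corner is `(c.1 * b ^ (-2 n), c.2 * b ^ (-n))`. -/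
def gridCell (b n : ℕ) (c : ℤ × ℤ) : Set (EuclideanSpace ℝ (Fin 2)) :=
  {η | (c.1 ≤ (b : ℝ) ^ (2 * n) * η 0 ∧ (b : ℝ) ^ (2 * n) * η 0 ≤ c.1 + 1) ∧
    (c.2 ≤ (b : ℝ) ^ n * η 1 ∧ (b : ℝ) ^ n * η 1 ≤ c.2 + 1)}

/-- The index of the `d`-th child of the cell `c`: the cell is divided into `b ^ 2` columns and
`b` rows. -/
def childCell (b : ℕ) (c : ℤ × ℤ) (d : Fin (b ^ 2) × Fin b) : ℤ × ℤ :=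
  (b ^ 2 * c.1 + (d.1 : ℕ), b * c.2 + (d.2 : ℕ))

/-- Given, at each level and each cell, a family `f n c` of children indexed by `Fin N`, the
cell of level `n` reached from the cell `(0, 0)` by following the digits of `ω`. -/
def codedCell {b N : ℕ} (f : ℕ → ℤ × ℤ → Fin N → Fin (b ^ 2) × Fin b) (ω : ℕ → Fin N) :
    ℕ → ℤ × ℤ
  | 0 => 0
  | n + 1 => childCell b (codedCell f ω n) (f n (codedCell f ω n) (ω n))

/-- The point common to all the cells reached along `ω`. -/
noncomputable def codedPoint {b N : ℕ} (f : ℕ → ℤ × ℤ → Fin N → Fin (b ^ 2) × Fin b)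
    (ω : ℕ → Fin N) : EuclideanSpace ℝ (Fin 2) :=
  !₂[⨆ n, (codedCell f ω n).1 / (b : ℝ) ^ (2 * n), ⨆ n, (codedCell f ω n).2 / (b : ℝ) ^ n]

theorem childCell_injective {b : ℕ} {c c' : ℤ × ℤ} {d d' : Fin (b ^ 2) × Fin b}
    (h : childCell b c d = childCell b c' d') : c = c' ∧ d = d' := by
  have aux : ∀ {k : ℕ} {p p' : ℤ} {i i' : Fin k}, (k : ℤ) * p + (i : ℕ) = k * p' + (i' : ℕ) →
      p = p' ∧ i = i' := by
    intro k p p' i i' h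
    have hi : ((i : ℕ) : ℤ) < k := by exact_mod_cast i.2
    have hi' : ((i' : ℕ) : ℤ) < k := by exact_mod_cast i'.2
    have hk : (k : ℤ) ≠ 0 := by omega
    have hp : p = p' := by
      have h1 := Int.add_mul_ediv_left ((i : ℕ) : ℤ) p hk
      have h2 := Int.add_mul_ediv_left ((i' : ℕ) : ℤ) p' hk
      rw [Int.ediv_eq_zero_of_lt (by omega) hi] at h1
      rw [Int.ediv_eq_zero_of_lt (by omega) hi', add_comm, ← h, add_comm, h1] at h2
      omega
    subst hp
    exact ⟨rfl, Fin.ext (by omega)⟩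
  simp only [childCell, Prod.mk.injEq] at h
  have h1 := h.1
  rw [← Nat.cast_pow] at h1
  exact ⟨Prod.ext (aux h1).1 (aux h.2).1, Prod.ext (aux h1).2 (aux h.2).2⟩

theorem codedCell_injective {b N : ℕ} {f : ℕ → ℤ × ℤ → Fin N → Fin (b ^ 2) × Fin b}
    (hf : ∀ n c, Function.Injective (f n c)) {ω ω' : ℕ → Fin N} :
    ∀ {n : ℕ}, codedCell f ω n = codedCell f ω' n → ∀ i < n, ω i = ω' i
  | 0, _, i, hi => by omega
  | n + 1, h, i, hi => by
    obtain ⟨h1, h2⟩ := childCell_injective h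
    rcases Nat.lt_succ_iff_lt_or_eq.1 hi with hi | rfl
    · exact codedCell_injective hf h1 i hi
    · rw [← h1] at h2
      exact hf _ _ h2

theorem mem_Icc_iSup_div_pow {k : ℕ} (hk : 0 < k) {a : ℕ → ℤ}
    (h : ∀ n, (k : ℤ) * a n ≤ a (n + 1) ∧ a (n + 1) + 1 ≤ k * (a n + 1)) (n : ℕ) :
    (a n : ℝ) ≤ (k : ℝ) ^ n * ⨆ n, a n / (k : ℝ) ^ n ∧
      (k : ℝ) ^ n * (⨆ n, a n / (k : ℝ) ^ n) ≤ a n + 1 := by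
  have hk' : (0 : ℝ) < k := by exact_mod_cast hk
  have h1 : Monotone fun n => a n / (k : ℝ) ^ n := by
    refine monotone_nat_of_le_succ fun n => ?_
    have : (k : ℝ) * a n ≤ a (n + 1) := by exact_mod_cast (h n).1
    rw [div_le_div_iff₀ (by positivity) (by positivity), pow_succ]
    nlinarith [pow_pos hk' n]
  have h2 : Antitone fun n => (a n + 1) / (k : ℝ) ^ n := by
    refine antitone_nat_of_succ_le fun n => ?_
    have : (a (n + 1) : ℝ) + 1 ≤ k * (a n + 1) := by exact_mod_cast (h n).2
    rw [div_le_div_iff₀ (by positivity) (by positivity), pow_succ]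
    nlinarith [pow_pos hk' n]
  have h3 := Set.mem_iInter.1 (h1.ciSup_mem_iInter_Icc_of_antitone h2 fun n => by
    simp only; gcongr; linarith) n
  simp only [Set.mem_Icc] at h3
  rw [div_le_iff₀' (by positivity), le_div_iff₀' (by positivity)] at h3
  exact h3

theorem codedPoint_mem_gridCell {b N : ℕ} (hb : 0 < b)
    (f : ℕ → ℤ × ℤ → Fin N → Fin (b ^ 2) × Fin b) (ω : ℕ → Fin N) (n : ℕ) :
    codedPoint f ω ∈ gridCell b n (codedCell f ω n) := by
  have aux : ∀ {k : ℕ} (p : ℤ) (i : Fin k), (k : ℤ) * p ≤ k * p + (i : ℕ) ∧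
      (k : ℤ) * p + (i : ℕ) + 1 ≤ k * (p + 1) := by
    intro k p i
    have : ((i : ℕ) : ℤ) < k := by exact_mod_cast i.2
    constructor <;> nlinarith
  have h0 := mem_Icc_iSup_div_pow (k := b ^ 2) (by positivity)
    (a := fun n => (codedCell f ω n).1) (fun n => by
      simp only [codedCell, childCell]
      rw [← Nat.cast_pow]
      exact aux _ _) n
  have h1 := mem_Icc_iSup_div_pow (k := b) hb
    (a := fun n => (codedCell f ω n).2) (fun n => by
      simp only [codedCell, childCell]
      exact aux _ _) n
  simp only [Nat.cast_pow, ← pow_mul] at h0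
  exact ⟨by simpa [codedPoint] using h0, by simpa [codedPoint] using h1⟩

section Measure

open MeasureTheory ProbabilityTheory ENNReal

theorem measurable_codedCell {b N : ℕ} (f : ℕ → ℤ × ℤ → Fin N → Fin (b ^ 2) × Fin b) (n : ℕ) :
    Measurable fun ω => codedCell f ω n := by
  induction n with
  | zero => exact measurable_const
  | succ n ih =>
    exact (Measurable.of_discrete
      (f := fun a : (ℤ × ℤ) × Fin N => childCell b a.1 (f n a.1 a.2))).comp
      (ih.prodMk (measurable_pi_apply n))

theorem measurable_codedPoint {b N : ℕ} (f : ℕ → ℤ × ℤ → Fin N → Fin (b ^ 2) × Fin b) :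
    Measurable (codedPoint f) := by
  have h0 : Measurable fun ω => ⨆ n, ((codedCell f ω n).1 : ℝ) / (b : ℝ) ^ (2 * n) :=
    Measurable.iSup fun n => (Measurable.of_discrete
      (f := fun c : ℤ × ℤ => (c.1 : ℝ) / (b : ℝ) ^ (2 * n))).comp (measurable_codedCell f n)
  have h1 : Measurable fun ω => ⨆ n, ((codedCell f ω n).2 : ℝ) / (b : ℝ) ^ n :=
    Measurable.iSup fun n => (Measurable.of_discrete
      (f := fun c : ℤ × ℤ => (c.2 : ℝ) / (b : ℝ) ^ n)).comp (measurable_codedCell f n)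
  refine (WithLp.measurable_toLp 2 (Fin 2 → ℝ)).comp (measurable_pi_lambda _ fun i => ?_)
  fin_cases i
  · exact h0
  · exact h1

/-- The uniform probability measure on the digit sequences. -/
noncomputable def digitMeasure (N : ℕ) : Measure (ℕ → Fin N) :=
  Measure.infinitePi fun _ => uniformOn Set.univ

instance (N : ℕ) [NeZero N] : IsProbabilityMeasure (digitMeasure N) := by
  unfold digitMeasure; infer_instance

theorem digitMeasure_codedCell_le {b N : ℕ} [NeZero N]
    {f : ℕ → ℤ × ℤ → Fin N → Fin (b ^ 2) × Fin b}
    (hf : ∀ n c, Function.Injective (f n c)) (n : ℕ) (c : ℤ × ℤ) :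
    digitMeasure N {ω | codedCell f ω n = c} ≤ ((N : ℝ≥0∞) ^ n)⁻¹ := by
  rcases Set.eq_empty_or_nonempty {ω | codedCell f ω n = c} with h | ⟨ω₀, h₀⟩
  · simp [h]
  · have hsub : {ω | codedCell f ω n = c} ⊆
        Set.pi (Finset.range n : Set ℕ) fun i => {ω₀ i} := by
      intro ω hω i hi
      exact codedCell_injective hf (hω.trans h₀.symm) i (by simpa using hi)
    refine (measure_mono hsub).trans ?_
    rw [digitMeasure, Measure.infinitePi_pi _ fun i _ => measurableSet_singleton _]
    simp [uniformOn_univ, ENNReal.inv_pow]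

/-- At most `16 * k` cells of a grid with sides `k ^ (-2)` and `k ^ (-1)` meet a square with
side `2 * k ^ (-1)`. -/
theorem exists_finset_cover_square {k : ℝ} (hk : 1 ≤ k) (u₀ u₁ : ℝ) :
    ∃ F : Finset (ℤ × ℤ), (F.card : ℝ) ≤ 16 * k ∧
      ∀ (c : ℤ × ℤ) (y₀ y₁ : ℝ), |y₀ - u₀| ≤ k⁻¹ → |y₁ - u₁| ≤ k⁻¹ →
        c.1 ≤ k ^ 2 * y₀ → k ^ 2 * y₀ ≤ c.1 + 1 → c.2 ≤ k * y₁ → k * y₁ ≤ c.2 + 1 → c ∈ F := by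
  have hk0 : 0 < k := by linarith
  have card : ∀ x y : ℝ, x ≤ y → ((Finset.Icc ⌈x⌉ ⌊y⌋).card : ℝ) ≤ y - x + 1 := by
    intro x y hxy
    rw [Int.card_Icc]
    have h1 := Int.floor_le y
    have h2 := Int.le_ceil x
    have h3 : ((⌊y⌋ + 1 - ⌈x⌉).toNat : ℝ) = ((max (⌊y⌋ + 1 - ⌈x⌉) 0 : ℤ) : ℝ) := by
      rw [← Int.toNat_eq_max, Int.cast_natCast]
    rw [h3]
    push_cast
    exact max_le (by linarith) (by linarith)
  have h0 : ∀ y u, |y - u| ≤ k⁻¹ → k * u - 1 ≤ k * y ∧ k * y ≤ k * u + 1 := by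
    intro y u h
    rw [abs_le] at h
    have e : k * k⁻¹ = 1 := mul_inv_cancel₀ hk0.ne'
    constructor <;> nlinarith
  refine ⟨Finset.Icc ⌈k ^ 2 * u₀ - k - 1⌉ ⌊k ^ 2 * u₀ + k⌋ ×ˢ
    Finset.Icc ⌈k * u₁ - 2⌉ ⌊k * u₁ + 1⌋, ?_, ?_⟩
  · rw [Finset.card_product]
    push_cast
    have h1 := card (k ^ 2 * u₀ - k - 1) (k ^ 2 * u₀ + k) (by linarith)
    have h2 := card (k * u₁ - 2) (k * u₁ + 1) (by linarith)
    calc _ ≤ (4 * k) * 4 := by gcongr <;> linarith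
      _ = _ := by ring
  · intro c y₀ y₁ hy₀ hy₁ h1 h2 h3 h4
    obtain ⟨h5, h6⟩ := h0 _ _ hy₀
    obtain ⟨h7, h8⟩ := h0 _ _ hy₁
    rw [Finset.mem_product, Finset.mem_Icc, Finset.mem_Icc, Int.ceil_le, Int.ceil_le,
      Int.le_floor, Int.le_floor]
    refine ⟨⟨?_, ?_⟩, ?_, ?_⟩
    · nlinarith
    · nlinarith
    · linarith
    · linarith

/-- A set of diameter at most `b ^ (-2 n)` carries at most `16 * b ^ (2 n) * N ^ (-2 n)` of the
mass of the Cantor set. The cells to count are those of level `2 * n`, whose *longer* side is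
the diameter: counting cells of level `n` would only give dimension `3 / 2`. -/
theorem map_codedPoint_le {b N : ℕ} [NeZero N] (hb : 0 < b)
    {f : ℕ → ℤ × ℤ → Fin N → Fin (b ^ 2) × Fin b}
    (hf : ∀ n c, Function.Injective (f n c)) (n : ℕ) {U : Set (EuclideanSpace ℝ (Fin 2))}
    (hU : Metric.ediam U ≤ ENNReal.ofReal ((b : ℝ) ^ (2 * n))⁻¹) :
    (digitMeasure N).map (codedPoint f) U ≤
      ENNReal.ofReal (16 * (b : ℝ) ^ (2 * n) * ((N : ℝ) ^ (2 * n))⁻¹) := by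
  rcases U.eq_empty_or_nonempty with rfl | ⟨u, hu⟩
  · simp
  have hb1 : (1 : ℝ) ≤ b := by exact_mod_cast hb
  have hN : (0 : ℝ) < N := by exact_mod_cast Nat.pos_of_neZero N
  set r : ℝ := ((b : ℝ) ^ (2 * n))⁻¹ with hr
  have hr0 : 0 ≤ r := by positivity
  let R : Set (EuclideanSpace ℝ (Fin 2)) := {y | |y 0 - u 0| ≤ r ∧ |y 1 - u 1| ≤ r}
  have hR : IsClosed R := by
    rw [show R = {y | |y 0 - u 0| ≤ r} ∩ {y | |y 1 - u 1| ≤ r} from rfl]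
    refine IsClosed.inter (isClosed_le ?_ continuous_const) (isClosed_le ?_ continuous_const) <;>
    fun_prop
  have hUR : U ⊆ R := by
    intro y hy
    have h1 : dist y u ≤ r := by
      have := (Metric.edist_le_ediam_of_mem hy hu).trans hU
      rwa [edist_dist, ENNReal.ofReal_le_ofReal_iff hr0] at this
    rw [dist_eq_norm] at h1
    exact ⟨(PiLp.norm_apply_le (y - u) 0).trans h1, (PiLp.norm_apply_le (y - u) 1).trans h1⟩
  obtain ⟨F, hFcard, hF⟩ :=
    exists_finset_cover_square (one_le_pow₀ hb1 (n := 2 * n)) (u 0) (u 1)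
  calc (digitMeasure N).map (codedPoint f) U
      ≤ (digitMeasure N).map (codedPoint f) R := measure_mono hUR
    _ = digitMeasure N (codedPoint f ⁻¹' R) :=
        Measure.map_apply (measurable_codedPoint f) hR.measurableSet
    _ ≤ digitMeasure N (⋃ c ∈ F, {ω | codedCell f ω (2 * n) = c}) := by
        refine measure_mono fun ω hω => ?_
        obtain ⟨⟨h1, h2⟩, h3, h4⟩ := codedPoint_mem_gridCell hb f ω (2 * n)
        have e : (b : ℝ) ^ (2 * (2 * n)) = ((b : ℝ) ^ (2 * n)) ^ 2 := by
          rw [← pow_mul]; congr 1; ring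
        rw [e] at h1 h2
        simp only [Set.mem_iUnion]
        exact ⟨_, hF _ _ _ hω.1 hω.2 h1 h2 h3 h4, rfl⟩
    _ ≤ ∑ c ∈ F, digitMeasure N {ω | codedCell f ω (2 * n) = c} :=
        measure_biUnion_finset_le _ _
    _ ≤ ∑ c ∈ F, ((N : ℝ≥0∞) ^ (2 * n))⁻¹ :=
        Finset.sum_le_sum fun c _ => digitMeasure_codedCell_le hf _ c
    _ = ENNReal.ofReal (F.card * ((N : ℝ) ^ (2 * n))⁻¹) := by
        rw [Finset.sum_const, nsmul_eq_mul, ENNReal.ofReal_mul (by positivity),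
          ENNReal.ofReal_inv_of_pos (by positivity), ENNReal.ofReal_pow hN.le,
          ENNReal.ofReal_natCast, ENNReal.ofReal_natCast]
    _ ≤ _ := by gcongr

/-- The mass distribution principle for the Cantor set. -/
theorem le_dimH_of_codedPoint_mem {b N : ℕ} (hb : 2 ≤ b) {s : NNReal} (hs : 0 < s)
    (hN : (b : ℝ) ^ (1 + s : ℝ) ≤ N) {f : ℕ → ℤ × ℤ → Fin N → Fin (b ^ 2) × Fin b}
    (hf : ∀ n c, Function.Injective (f n c)) {E : Set (EuclideanSpace ℝ (Fin 2))}
    (hE : ∀ ω, codedPoint f ω ∈ E) : s ≤ dimH E := by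
  have hb1 : (1 : ℝ) < b := by exact_mod_cast hb
  have hb0 : (0 : ℝ) < b := by linarith
  have hN0 : (0 : ℝ) < N := lt_of_lt_of_le (by positivity) hN
  have : NeZero N := ⟨by rintro rfl; simp at hN0⟩
  have hs' : (0 : ℝ) < s := hs
  set ν := (digitMeasure N).map (codedPoint f) with hν
  set r : ℝ := ((b : ℝ) ^ 2)⁻¹ with hr
  have hr0 : 0 < r := by positivity
  have hr1 : r < 1 := inv_lt_one_of_one_lt₀ (one_lt_pow₀ hb1 two_ne_zero)
  set C : ℝ := 16 * (r ^ (s : ℝ))⁻¹ with hC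
  have hC0 : 0 < C := by positivity
  have key : ∀ (n : ℕ) (U : Set (EuclideanSpace ℝ (Fin 2))),
      Metric.ediam U ≤ ENNReal.ofReal (r ^ n) →
      ν U ≤ ENNReal.ofReal (C * (r ^ (n + 1)) ^ (s : ℝ)) := by
    intro n U hU
    refine (map_codedPoint_le (by omega) hf n (hU.trans (le_of_eq ?_))).trans ?_
    · rw [hr, inv_pow, pow_mul]
    · apply ENNReal.ofReal_le_ofReal
      have h1 : (b : ℝ) * (b : ℝ) ^ (s : ℝ) ≤ N := by
        rwa [Real.rpow_add hb0, Real.rpow_one] at hN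
      have h2 : (b : ℝ) ^ (2 * n) * ((b : ℝ) ^ (2 * n)) ^ (s : ℝ) ≤ (N : ℝ) ^ (2 * n) := by
        calc (b : ℝ) ^ (2 * n) * ((b : ℝ) ^ (2 * n)) ^ (s : ℝ)
            = ((b : ℝ) * (b : ℝ) ^ (s : ℝ)) ^ (2 * n) := by
              rw [mul_pow, Real.rpow_pow_comm hb0.le]
          _ ≤ _ := by gcongr
      have h3 : C * (r ^ (n + 1)) ^ (s : ℝ) = 16 * (((b : ℝ) ^ (2 * n)) ^ (s : ℝ))⁻¹ := by
        have e : r ^ n = ((b : ℝ) ^ (2 * n))⁻¹ := by rw [hr, inv_pow, pow_mul]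
        have hrs : r ^ (s : ℝ) ≠ 0 := (Real.rpow_pos_of_pos hr0 _).ne'
        rw [hC, pow_succ, Real.mul_rpow (by positivity) hr0.le, e,
          Real.inv_rpow (by positivity : (0 : ℝ) ≤ (b : ℝ) ^ (2 * n)) s]
        generalize r ^ (s : ℝ) = ρ at hrs
        field_simp
      rw [h3, mul_assoc]
      gcongr
      rw [← div_eq_mul_inv, div_le_iff₀ (by positivity), ← div_eq_inv_mul,
        le_div_iff₀ (by positivity)]
      exact h2
  have hmass : ∀ U : Set (EuclideanSpace ℝ (Fin 2)), Metric.ediam U ≤ 1 →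
      ν U ≤ ENNReal.ofReal C * Metric.ediam U ^ (s : ℝ) := by
    intro U hU
    have hfin : Metric.ediam U ≠ ∞ := ne_top_of_le_ne_top one_ne_top hU
    obtain ⟨d, hd0, hd⟩ : ∃ d : ℝ, 0 ≤ d ∧ Metric.ediam U = ENNReal.ofReal d :=
      ⟨_, ENNReal.toReal_nonneg, (ENNReal.ofReal_toReal hfin).symm⟩
    rw [hd, ENNReal.ofReal_rpow_of_nonneg hd0 hs'.le, ← ENNReal.ofReal_mul hC0.le]
    rcases hd0.eq_or_lt with rfl | hd0
    · -- A set of diameter zero is a null set, as it is small at every scale.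
      have hlim : Filter.Tendsto (fun n : ℕ => ENNReal.ofReal (C * (r ^ (n + 1)) ^ (s : ℝ)))
          Filter.atTop (nhds (ENNReal.ofReal (C * (0 : ℝ) ^ (s : ℝ)))) := by
        refine ENNReal.tendsto_ofReal (Filter.Tendsto.const_mul _ ?_)
        exact ((tendsto_pow_atTop_nhds_zero_of_lt_one hr0.le hr1).comp
          (Filter.tendsto_add_atTop_nat 1)).rpow_const (Or.inr hs'.le)
      exact ge_of_tendsto' hlim fun n => key n U (by rw [hd]; simp)
    · have hd1 : d ≤ 1 := by
        rw [hd] at hU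
        simpa using hU
      obtain ⟨n, hn1, hn2⟩ := exists_nat_pow_near_of_lt_one hd0 hd1 hr0 hr1
      refine (key n U (by rw [hd]; exact ENNReal.ofReal_le_ofReal hn2)).trans ?_
      gcongr
  have hC' : ENNReal.ofReal C ≠ 0 := by simpa using hC0
  have hle : (ENNReal.ofReal C)⁻¹ • ν ≤ Measure.hausdorffMeasure (s : ℝ) := by
    refine Measure.le_hausdorffMeasure _ _ 1 one_pos fun U hU => ?_
    rw [Measure.smul_apply, smul_eq_mul, mul_comm, ← div_eq_mul_inv]
    exact ENNReal.div_le_of_le_mul' (hmass U hU)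
  refine le_dimH_of_hausdorffMeasure_ne_zero (ne_of_gt ?_)
  refine lt_of_lt_of_le ?_ (hle E)
  rw [Measure.smul_apply, smul_eq_mul]
  refine ENNReal.mul_pos (by simp) (ne_of_gt ?_)
  have h1 : codedPoint f ⁻¹' E = Set.univ := Set.eq_univ_of_forall hE
  have h2 := Measure.le_map_apply (measurable_codedPoint f).aemeasurable E (μ := digitMeasure N)
  rw [h1, measure_univ] at h2
  exact lt_of_lt_of_le one_pos h2

end Measure

/-! ### Removing the strips around one family of parallel lines -/

/-- At most `7` integers lie in an interval of length `6`. -/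
theorem card_filter_abs_add_le {k : ℕ} (z : ℝ) :
    (Finset.univ.filter fun i : Fin k => |((i : ℕ) : ℝ) + z| ≤ 3).card ≤ 7 := by
  have h : ((Finset.univ.filter fun i : Fin k => |((i : ℕ) : ℝ) + z| ≤ 3).image
      fun i : Fin k => ((i : ℕ) : ℤ)) ⊆ Finset.Icc ⌈-3 - z⌉ (⌈-3 - z⌉ + 6) := by
    intro j hj
    obtain ⟨i, hi, rfl⟩ := Finset.mem_image.1 hj
    have h1 := abs_le.1 (Finset.mem_filter.1 hi).2
    rw [Finset.mem_Icc]
    refine ⟨Int.ceil_le.2 (by push_cast; linarith), ?_⟩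
    have h2 := Int.le_ceil (-3 - z)
    have : (((i : ℕ) : ℤ) : ℝ) ≤ ((⌈-3 - z⌉ + 6 : ℤ) : ℝ) := by push_cast; linarith
    exact_mod_cast this
  have h2 := Finset.card_le_card h
  rw [Finset.card_image_of_injective _ (fun i j hij => Fin.ext (by exact_mod_cast hij)),
    Int.card_Icc] at h2
  omega

theorem card_filter_abs_mul_add_le {k : ℕ} {α δ : ℝ} (hα : 0 < |α|) (hδ : δ ≤ 3 * |α|) (z : ℝ) :
    (Finset.univ.filter fun i : Fin k => |α * ((i : ℕ) : ℝ) + z| ≤ δ).card ≤ 7 := by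
  refine (Finset.card_le_card fun i hi => ?_).trans (card_filter_abs_add_le (k := k) (z / α))
  simp only [Finset.mem_filter, Finset.mem_univ, true_and] at hi ⊢
  have e : α * ((i : ℕ) : ℝ) + z = α * ((i : ℕ) + z / α) := by
    have : α ≠ 0 := abs_pos.1 hα
    field_simp
  rw [e, abs_mul] at hi
  exact le_of_mul_le_mul_left (by linarith) hα

/-- A strip about a line, of thickness comparable to one cell, meets at most `7 * max k l` cells
of a `k × l` array: it is crossed transversally by the rows or by the columns, according to
which coefficient of the line dominates. -/
theorem card_filter_strip_le {k l : ℕ} {α β ε : ℝ} (hα : ε ≤ |α| ∨ ε ≤ |β|) (hε : 0 < ε) (γ : ℝ) :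
    (Finset.univ.filter fun d : Fin k × Fin l =>
      |α * ((d.1 : ℕ) : ℝ) + β * ((d.2 : ℕ) : ℝ) + γ| ≤ |α| + |β| + ε).card ≤ 7 * max k l := by
  rw [Finset.card_filter, ← Finset.univ_product_univ]
  rcases le_total |β| |α| with h | h
  · have hα' : ε ≤ |α| := hα.elim id fun h' => h'.trans h
    rw [Finset.sum_product_right]
    calc _ ≤ ∑ _j : Fin l, 7 := Finset.sum_le_sum fun j _ => by
          rw [← Finset.card_filter]
          simp only [add_assoc]
          exact card_filter_abs_mul_add_le (hε.trans_le hα') (by linarith) _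
      _ ≤ _ := by simp [mul_comm]
  · have hβ' : ε ≤ |β| := hα.elim (fun h' => h'.trans h) id
    rw [Finset.sum_product]
    calc _ ≤ ∑ _i : Fin k, 7 := Finset.sum_le_sum fun i _ => by
          rw [← Finset.card_filter]
          simp only [add_comm (α * _), add_assoc]
          exact card_filter_abs_mul_add_le (hε.trans_le hβ') (by linarith) _
      _ ≤ _ := by simp [mul_comm]

/-- For a shell vector `m` of level `n`, the value `m₁ * η₁ + m₂ * η₂` stays
within `1 / 4` of its value at a corner on a cell of level `n + 1`, so that only one integer is
approached, along a single strip. Hence `b ^ 2 * (b - 7)` of the `b ^ 3` children avoid all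
integers by `b ^ (-6)`. -/
theorem exists_children_avoiding {b : ℕ} (hb : 8 ≤ b) {m : ℤ × ℤ} {n : ℕ}
    (h1 : |m.1| ≤ (b : ℤ) ^ (2 * n)) (h2 : |m.2| ≤ (b : ℤ) ^ n)
    (h3 : (b : ℤ) ^ (2 * n) < b ^ 2 * |m.1| ∨ (b : ℤ) ^ n < b * |m.2|) (c : ℤ × ℤ) :
    ∃ f : Fin (b ^ 2 * (b - 7)) → Fin (b ^ 2) × Fin b, Function.Injective f ∧
      ∀ k, ∀ η ∈ gridCell b (n + 2) (childCell b c (f k)), ∀ p : ℤ,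
        ((b : ℝ) ^ 6)⁻¹ ≤ |m.1 * η 0 + m.2 * η 1 - p| := by
  have hb8 : (8 : ℝ) ≤ b := by exact_mod_cast hb
  have hb0 : (0 : ℝ) < b := by linarith
  have h1' : |(m.1 : ℝ)| ≤ (b : ℝ) ^ (2 * n) := by exact_mod_cast h1
  have h2' : |(m.2 : ℝ)| ≤ (b : ℝ) ^ n := by exact_mod_cast h2
  set ε : ℝ := ((b : ℝ) ^ 6)⁻¹ with hε
  have hε0 : 0 < ε := by positivity
  have hbinv : (b : ℝ)⁻¹ ≤ 1 / 8 := by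
    rw [one_div]; exact inv_anti₀ (by norm_num) hb8
  have hbinv0 : (0 : ℝ) < (b : ℝ)⁻¹ := by positivity
  have hε1 : ε ≤ (b : ℝ)⁻¹ :=
    inv_anti₀ hb0 (le_self_pow₀ (by linarith) (by norm_num))
  set w : ℝ := ((b : ℝ) ^ (2 * (n + 2)))⁻¹ with hw
  set h : ℝ := ((b : ℝ) ^ (n + 2))⁻¹ with hh
  have hw0 : 0 < w := by positivity
  have hh0 : 0 < h := by positivity
  set α : ℝ := m.1 * w with hα
  set β : ℝ := m.2 * h with hβ
  have hαb : |α| * (b : ℝ) ^ 2 ≤ (b : ℝ)⁻¹ := by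
    calc |α| * (b : ℝ) ^ 2 = |(m.1 : ℝ)| * (w * (b : ℝ) ^ 2) := by
          rw [hα, abs_mul, abs_of_pos hw0]; ring
      _ ≤ (b : ℝ) ^ (2 * n) * (w * (b : ℝ) ^ 2) := by gcongr
      _ = (b : ℝ)⁻¹ * (b : ℝ)⁻¹ := by rw [hw]; field_simp; ring
      _ ≤ (b : ℝ)⁻¹ := by nlinarith
  have hβb : |β| * b ≤ (b : ℝ)⁻¹ := by
    calc |β| * b = |(m.2 : ℝ)| * (h * b) := by
          rw [hβ, abs_mul, abs_of_pos hh0]; ring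
      _ ≤ (b : ℝ) ^ n * (h * b) := by gcongr
      _ = (b : ℝ)⁻¹ := by rw [hh]; field_simp; ring
  have hαβ : ε ≤ |α| ∨ ε ≤ |β| := by
    rcases h3 with h3 | h3
    · left
      have h3' : (b : ℝ) ^ (2 * n) ≤ b ^ 2 * |(m.1 : ℝ)| := by exact_mod_cast h3.le
      rw [hα, abs_mul, abs_of_pos hw0]
      calc ε = ((b : ℝ) ^ 2)⁻¹ * (b : ℝ) ^ (2 * n) * w := by
            rw [hε, hw]; field_simp; ring
        _ ≤ ((b : ℝ) ^ 2)⁻¹ * (b ^ 2 * |(m.1 : ℝ)|) * w := by gcongr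
        _ = _ := by field_simp
    · right
      have h3' : (b : ℝ) ^ n ≤ b * |(m.2 : ℝ)| := by exact_mod_cast h3.le
      rw [hβ, abs_mul, abs_of_pos hh0]
      calc ε ≤ ((b : ℝ) ^ 3)⁻¹ :=
            inv_anti₀ (by positivity) (pow_le_pow_right₀ (by linarith) (by norm_num))
        _ = (b : ℝ)⁻¹ * (b : ℝ) ^ n * h := by
            rw [hh]; field_simp; ring
        _ ≤ (b : ℝ)⁻¹ * (b * |(m.2 : ℝ)|) * h := by gcongr
        _ = _ := by field_simp
  -- The value of the form at the corner of the parent cell.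
  set γ : ℝ := α * (b ^ 2 * c.1) + β * (b * c.2) with hγ
  -- The value of the form at a point of a child, in terms of the position of the child.
  have hval : ∀ (d : Fin (b ^ 2) × Fin b), ∀ η ∈ gridCell b (n + 2) (childCell b c d),
      ∃ s t : ℝ, 0 ≤ s ∧ s ≤ 1 ∧ 0 ≤ t ∧ t ≤ 1 ∧
        m.1 * η 0 + m.2 * η 1 = γ + α * ((d.1 : ℕ) + s) + β * ((d.2 : ℕ) + t) := by
    rintro d η ⟨⟨u1, u2⟩, u3, u4⟩
    simp only [childCell] at u1 u2 u3 u4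
    push_cast at u1 u2 u3 u4
    refine ⟨(b : ℝ) ^ (2 * (n + 2)) * η 0 - (b ^ 2 * c.1 + (d.1 : ℕ)),
      (b : ℝ) ^ (n + 2) * η 1 - (b * c.2 + (d.2 : ℕ)), by linarith, by linarith, by linarith,
      by linarith, ?_⟩
    have e0 : w * (b : ℝ) ^ (2 * (n + 2)) = 1 := inv_mul_cancel₀ (by positivity)
    have e1 : h * (b : ℝ) ^ (n + 2) = 1 := inv_mul_cancel₀ (by positivity)
    rw [hγ, hα, hβ]
    linear_combination (-(m.1 : ℝ) * η 0) * e0 + (-(m.2 : ℝ) * η 1) * e1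
  have hmul : ∀ (a s : ℝ), 0 ≤ s → s ≤ 1 → |a * s| ≤ |a| := by
    intro a s hs hs'
    rw [abs_mul, abs_of_nonneg hs]
    exact mul_le_of_le_one_right (abs_nonneg _) hs'
  have hclose : ∀ (d : Fin (b ^ 2) × Fin b), ∀ η ∈ gridCell b (n + 2) (childCell b c d),
      |m.1 * η 0 + m.2 * η 1 - γ| ≤ 1 / 4 := by
    intro d η hη
    obtain ⟨s, t, hs, hs', ht, ht', e⟩ := hval d η hη
    have d1 : ((d.1 : ℕ) : ℝ) + 1 ≤ (b : ℝ) ^ 2 := by exact_mod_cast d.1.2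
    have d2 : ((d.2 : ℕ) : ℝ) + 1 ≤ b := by exact_mod_cast d.2.2
    rw [e, show γ + α * ((d.1 : ℕ) + s) + β * ((d.2 : ℕ) + t) - γ
      = α * ((d.1 : ℕ) + s) + β * ((d.2 : ℕ) + t) by ring]
    refine (abs_add_le _ _).trans ?_
    rw [abs_mul α, abs_mul β, abs_of_nonneg (by positivity : (0 : ℝ) ≤ (d.1 : ℕ) + s),
      abs_of_nonneg (by positivity : (0 : ℝ) ≤ (d.2 : ℕ) + t)]
    have k1 : |α| * ((d.1 : ℕ) + s) ≤ |α| * (b : ℝ) ^ 2 := by gcongr; linarith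
    have k2 : |β| * ((d.2 : ℕ) + t) ≤ |β| * b := by gcongr; linarith
    linarith
  -- As `1 / 4 + ε < 1 / 2`, the integer nearest to `γ` is the only one that can be approached.
  set B := Finset.univ.filter fun d : Fin (b ^ 2) × Fin b =>
    |α * ((d.1 : ℕ) : ℝ) + β * ((d.2 : ℕ) : ℝ) + (γ - round γ)| ≤ |α| + |β| + ε with hB
  have hBcard : B.card ≤ 7 * b ^ 2 := by
    refine (card_filter_strip_le hαβ hε0 _).trans (le_of_eq ?_)
    rw [max_eq_left (Nat.le_self_pow two_ne_zero b)]
  have hgood : ∀ d ∉ B, ∀ η ∈ gridCell b (n + 2) (childCell b c d), ∀ p : ℤ,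
      ε ≤ |m.1 * η 0 + m.2 * η 1 - p| := by
    intro d hd η hη p
    by_contra! hlt
    have hp : p = round γ := by
      have h4 : |γ - p| < 1 / 2 := by
        have := hclose d η hη
        rw [abs_le] at this
        rw [abs_lt] at hlt ⊢
        constructor <;> linarith [this.1, this.2, hlt.1, hlt.2]
      have h5 := abs_sub_round γ
      have h6 : |((p - round γ : ℤ) : ℝ)| < 1 := by
        rw [abs_lt] at h4 ⊢
        rw [abs_le] at h5
        push_cast
        constructor <;> linarith [h4.1, h4.2, h5.1, h5.2]
      have h7 : |p - round γ| < 1 := by exact_mod_cast h6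
      have := Int.abs_lt_one_iff.1 h7
      omega
    subst hp
    apply hd
    rw [hB, Finset.mem_filter]
    refine ⟨Finset.mem_univ _, ?_⟩
    obtain ⟨s, t, hs, hs', ht, ht', e⟩ := hval d η hη
    rw [e] at hlt
    have k1 := abs_le.1 (hmul α s hs hs')
    have k2 := abs_le.1 (hmul β t ht ht')
    rw [abs_lt] at hlt
    rw [abs_le]
    constructor <;> linarith [k1.1, k1.2, k2.1, k2.2, hlt.1, hlt.2]
  have hcard : Fintype.card (Fin (b ^ 2 * (b - 7))) ≤ Fintype.card {d // d ∈ Bᶜ} := by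
    rw [Fintype.card_fin, Fintype.card_coe, Finset.card_compl, Fintype.card_prod,
      Fintype.card_fin, Fintype.card_fin, Nat.mul_sub]
    omega
  obtain ⟨g⟩ := Function.Embedding.nonempty_of_card_le hcard
  exact ⟨fun k => (g k).1, fun i j hij => g.injective (Subtype.ext hij),
    fun k => hgood _ (Finset.mem_compl.1 (g k).2)⟩

/-! ### The dimension of the set of badly approximable points -/

/-- As the number `b ^ 2 * (b - 7)` of children kept is close to `b ^ 3` for large `b`, the
Cantor sets have dimension arbitrarily close to `2`. -/
theorem le_dimH_inhomBad (Θ : EuclideanSpace ℝ (Fin 2)) {s : NNReal} (hs : 0 < s) (hs2 : s < 2) :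
    s ≤ dimH (inhomBad (2 / 3) (1 / 3) Θ) := by
  have hs2' : (0 : ℝ) < 2 - s := by
    have : (s : ℝ) < 2 := by exact_mod_cast hs2
    linarith
  obtain ⟨b, hb, hb2⟩ : ∃ b : ℕ, 14 ≤ b ∧ (2 : ℝ) ≤ (b : ℝ) ^ (2 - s : ℝ) :=
    ((Filter.eventually_ge_atTop 14).and
      (((tendsto_rpow_atTop hs2').comp tendsto_natCast_atTop_atTop).eventually_ge_atTop 2)).exists
  have hb14 : (14 : ℝ) ≤ b := by exact_mod_cast hb
  have hb0 : (0 : ℝ) < b := by linarith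
  obtain ⟨v, hv, hΘ⟩ := exists_shell_vectors (Θ 0) (Θ 1) (b := b) (by omega)
  choose g hg hgood using fun n => exists_children_avoiding (by omega : 8 ≤ b)
    (hv n).1 (hv n).2.1 (hv n).2.2
  -- The shell vector of level `n` acts on the cells of level `n + 1`; the first step is free.
  let f : ℕ → ℤ × ℤ → Fin (b ^ 2 * (b - 7)) → Fin (b ^ 2) × Fin b := fun n => g (n - 1)
  refine le_dimH_of_codedPoint_mem (by omega : 2 ≤ b) hs ?_ (f := f) (fun n c => hg _ c) ?_
  · have e : (b : ℝ) ^ (1 + s : ℝ) * (b : ℝ) ^ (2 - s : ℝ) = (b : ℝ) ^ 3 := by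
      rw [← Real.rpow_add hb0, ← Real.rpow_natCast]
      congr 1
      push_cast
      ring
    have hpos : 0 < (b : ℝ) ^ (1 + s : ℝ) := by positivity
    push_cast [Nat.cast_sub (by omega : 7 ≤ b)]
    nlinarith [mul_le_mul_of_nonneg_left hb2 hpos.le, pow_pos hb0 2]
  · intro ω
    refine mem_inhomBad_of_shell_vectors (by omega) (fun n => ⟨(hv n).1, (hv n).2.1⟩) hΘ
      (ε := ((b : ℝ) ^ 6)⁻¹) (by positivity)
      (inv_le_one_of_one_le₀ (one_le_pow₀ (by linarith))) fun n p => ?_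
    exact hgood n (codedCell f ω (n + 1)) (ω (n + 1)) _
      (codedPoint_mem_gridCell (by omega) f ω (n + 2)) p

theorem mainTheorem1 (Θ : EuclideanSpace ℝ (Fin 2)) :
    (inhomBad (2 / 3) (1 / 3) Θ).Nonempty ∧ dimH (inhomBad (2 / 3) (1 / 3) Θ) = 2 := by
  have hdim : dimH (inhomBad (2 / 3) (1 / 3) Θ) = 2 := by
    refine le_antisymm ?_ ?_
    · refine (dimH_mono (Set.subset_univ _)).trans (le_of_eq ?_)
      rw [Real.dimH_univ_eq_finrank, finrank_euclideanSpace_fin]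
      rfl
    · refine le_of_forall_lt fun a ha => ?_
      lift a to NNReal using ha.ne_top
      obtain ⟨s, has, hs2⟩ := exists_between (show a < 2 by exact_mod_cast ha)
      exact lt_of_lt_of_le (by exact_mod_cast has)
        (le_dimH_inhomBad Θ (lt_of_le_of_lt zero_le has) hs2)
  refine ⟨Set.nonempty_iff_ne_empty.2 fun h => ?_, hdim⟩
  rw [h, dimH_empty] at hdim
  exact two_ne_zero hdim.symm
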